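/- Let $M$ be a smooth $n$-dimensional manifold and let $F:TM\to[0,\infty)$ be a Finsler metric: $F$ is $C^\infty$ on $TM\setminus\{0\}$, $F(x,\lambda y)=\lambda F(x,y)$ for $\lambda>0$, and $g_{ij}(x,y)=\frac12[F^2]_{y^iy^j}(x,y)$ is positive definite for all $y\neq0$. Let $V$ be a vector field on $M$ of class $C^2$ (for instance a smooth one). Fix any local coordinates $(x^i)$ of $M$, with induced coordinates $(x^i,y^i)$ of $TM$, and use the summation convention. Put $$G^i=\tfrac14 g^{il}\{[F^2]_{x^ky^l}y^k-[F^2]_{x^l}\},\quad N^i_j=\frac{\partial G^i}{\partial y^j},\quad \frac{\delta}{\delta x^i}=\frac{\partial}{\partial x^i}-N^j_i\frac{\partial}{\partial y^j},$$ let $$\Gamma^i_{jk}=\tfrac12 g^{il}\Big(\frac{\delta g_{lk}}{\delta x^j}+\frac{\delta g_{jl}}{\delta x^k}-\frac{\delta g_{jk}}{\delta x^l}\Big)$$ be the coefficients of the Chern connection $D$ on $\pi^*TM$, where $\pi:TM\setminus\{0\}\to M$, so that $D_\zeta\partial_j=\Gamma^i_{jk}\,dx^k(\zeta)\,\partial_i$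 for the frame $\partial_i=(x,y,\frac{\partial}{\partial x^i})$ of $\pi^*TM$ and vector fields $\zeta$ on $TM\setminus\{0\}$, and let $$R_j{}^i{}_{kl}=\frac{\delta\Gamma^i_{jl}}{\delta x^k}-\frac{\delta\Gamma^i_{jk}}{\delta x^l}+\Gamma^i_{mk}\Gamma^m_{jl}-\Gamma^i_{ml}\Gamma^m_{jk},\qquad P_j{}^i{}_{kl}=\frac{\partial\Gamma^i_{jk}}{\partial y^l}$$ be the Chern curvature and the Landsberg tensor. The horizontal covariant derivatives of $V$ are $$V^i{}_{|j}=\frac{\delta V^i}{\delta x^j}+V^m\Gamma^i_{mj},\qquad V^i{}_{|j|k}=\frac{\delta V^i{}_{|j}}{\delta x^k}+V^m{}_{|j}\Gamma^i_{mk}-V^i{}_{|m}\Gamma^m_{jk}.$$ Let $\hat V=V^i\frac{\partial}{\partial x^i}+y^m\frac{\partial V^i}{\partial x^m}\frac{\partial}{\partial y^i}$ be the complete lift of $V$. Let $\rho:T(TM\setminus\{0\})\to\pi^*TM$ be the bundle map with $\rho(\frac{\partial}{\partial x^i})=\partial_i$ and $\rho(\frac{\partial}{\partial y^i})=0$. For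 a section $X=X^i\partial_i$ of $\pi^*TM$, put $\mathcal L_{\hat V}X=\rho[\hat V,X]$, where inside the bracket $X$ is identified with the horizontal vector field $X^i\frac{\delta}{\delta x^i}$. Define $$(\mathcal L_{\hat V}D)(\zeta,X)=\mathcal L_{\hat V}(D_\zeta X)-D_{[\hat V,\zeta]}X-D_\zeta(\mathcal L_{\hat V}X),\qquad (\mathcal L_{\hat V}D)(\partial_j,\partial_k)=(\mathcal L_{\hat V}\Gamma^i_{jk})\,\partial_i,$$ where the first argument $\partial_j$ is likewise identified with $\frac{\delta}{\delta x^j}$. Then, for all $i,j,k$, at every point $(x,y)$ of the coordinate domain with $y\neq0$, $$\mathcal L_{\hat V}\Gamma^i_{jk}=R_j{}^i{}_{mk}V^m+V^i{}_{|j|k}+y^mV^l{}_{|m}P_j{}^i{}_{kl}.$$ -/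

import Mathlib

open scoped Manifold ContDiff

noncomputable section

namespace Finsler

/-! ### Finsler metrics on a manifold -/

section Manifold

variable {n : ℕ} {M : Type*} [TopologicalSpace M] [ChartedSpace (EuclideanSpace ℝ (Fin n)) M]

/-- The fundamental form `g_y(u, v) = (1/2) ∂²/∂s∂t F²(y + s u + t v)` at `s = t = 0`,
for `y, u, v` in the tangent space at `p`. -/
def fundamentalForm (F : TangentBundle (𝓡 n) M → ℝ) (p : M) (y u v : TangentSpace (𝓡 n) p) : ℝ :=
  (1 / 2) * deriv (fun s : ℝ => deriv (fun t : ℝ => F ⟨p, y + s • u + t • v⟩ ^ 2) 0) 0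

/-- A Finsler metric: a nonnegative function on `TM`, smooth away from the zero section, whose
restriction to every tangent space is a Minkowski function, that is, positively homogeneous of
degree one with positive definite fundamental form at every nonzero vector. -/
structure IsFinslerMetric [IsManifold (𝓡 n) ∞ M] (F : TangentBundle (𝓡 n) M → ℝ) : Prop where
  nonneg : ∀ v, 0 ≤ F v
  smooth : ContMDiffOn (𝓡 n).tangent 𝓘(ℝ, ℝ) ∞ F {v | v.2 ≠ 0}
  homogeneous : ∀ (p : M) (y : TangentSpace (𝓡 n) p) (c : ℝ), 0 < c →
    F ⟨p, c • y⟩ = c * F ⟨p, y⟩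
  posDef : ∀ (p : M) (y u : TangentSpace (𝓡 n) p), y ≠ 0 → u ≠ 0 →
    0 < fundamentalForm F p y u u

/-- The expression `F(x, y) = F(yⁱ ∂/∂xⁱ|ₓ)` of a function on `TM` in the coordinates
`(xⁱ, yⁱ)` of `TM` induced by a chart `e` of `M`. -/
def localMetric (e : OpenPartialHomeomorph M (EuclideanSpace ℝ (Fin n)))
    (F : TangentBundle (𝓡 n) M → ℝ) :
    EuclideanSpace ℝ (Fin n) × EuclideanSpace ℝ (Fin n) → ℝ :=
  fun p => F ⟨e.symm p.1, mfderiv (𝓡 n) (𝓡 n) e.symm p.1 p.2⟩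

/-- The components `Vⁱ(x)` of a vector field on `M` in the chart `e`. -/
def localField (e : OpenPartialHomeomorph M (EuclideanSpace ℝ (Fin n)))
    (V : ∀ p : M, TangentSpace (𝓡 n) p) :
    EuclideanSpace ℝ (Fin n) → EuclideanSpace ℝ (Fin n) :=
  fun x => mfderiv (𝓡 n) (𝓡 n) e (e.symm x) (V (e.symm x))

end Manifold

/-! ### Finsler geometry in the coordinates `(xⁱ, yⁱ)` of the tangent bundle

Below, `L` is the coordinate expression of the Finsler metric and points `p = (x, y)` are pairs.
A vector field on `TM₀` is a map into pairs: its components along `∂/∂xⁱ` and along `∂/∂yⁱ`.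
A section of `π*TM` is given by its components in the frame `∂ᵢ`. -/

section Coordinates

variable {n : ℕ}

/-- The partial derivative `∂f/∂xⁱ` of a function of `(x, y)`. -/
def dx (i : Fin n) (f : EuclideanSpace ℝ (Fin n) × EuclideanSpace ℝ (Fin n) → ℝ)
    (p : EuclideanSpace ℝ (Fin n) × EuclideanSpace ℝ (Fin n)) : ℝ :=
  fderiv ℝ f p (EuclideanSpace.single i 1, 0)

/-- The partial derivative `∂f/∂yⁱ` of a function of `(x, y)`. -/
def dy (i : Fin n) (f : EuclideanSpace ℝ (Fin n) × EuclideanSpace ℝ (Fin n) → ℝ)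
    (p : EuclideanSpace ℝ (Fin n) × EuclideanSpace ℝ (Fin n)) : ℝ :=
  fderiv ℝ f p (0, EuclideanSpace.single i 1)

variable (L : EuclideanSpace ℝ (Fin n) × EuclideanSpace ℝ (Fin n) → ℝ)

/-- The fundamental tensor `g_ij = (1/2) [F²]_{yⁱ yʲ}`. -/
def metricCoeff (p : EuclideanSpace ℝ (Fin n) × EuclideanSpace ℝ (Fin n)) :
    Matrix (Fin n) (Fin n) ℝ :=
  Matrix.of fun i j => (1 / 2) * dy j (dy i fun q => L q ^ 2) p

/-- The spray coefficients `Gⁱ = (1/4) gⁱˡ ([F²]_{xᵏ yˡ} yᵏ - [F²]_{xˡ})`. -/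
def sprayCoeff (i : Fin n) (p : EuclideanSpace ℝ (Fin n) × EuclideanSpace ℝ (Fin n)) : ℝ :=
  (1 / 4) * ∑ l, (metricCoeff L p)⁻¹ i l *
    ((∑ k, dy l (dx k fun q => L q ^ 2) p * p.2 k) - dx l (fun q => L q ^ 2) p)

/-- The nonlinear connection `Nⁱ_j = ∂Gⁱ/∂yʲ`. -/
def nonlinCoeff (i j : Fin n) (p : EuclideanSpace ℝ (Fin n) × EuclideanSpace ℝ (Fin n)) : ℝ :=
  dy j (sprayCoeff L i) p

/-- The horizontal derivative `δf/δxⁱ = ∂f/∂xⁱ - Nʲ_i ∂f/∂yʲ`. -/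
def deltaX (i : Fin n) (f : EuclideanSpace ℝ (Fin n) × EuclideanSpace ℝ (Fin n) → ℝ)
    (p : EuclideanSpace ℝ (Fin n) × EuclideanSpace ℝ (Fin n)) : ℝ :=
  dx i f p - ∑ j, nonlinCoeff L j i p * dy j f p

/-- The coefficients of the Chern connection,
`Γⁱ_jk = (1/2) gⁱˡ (δg_lk/δxʲ + δg_jl/δxᵏ - δg_jk/δxˡ)`; see `chernCoeff_unique`. -/
def chernCoeff (i j k : Fin n)
    (p : EuclideanSpace ℝ (Fin n) × EuclideanSpace ℝ (Fin n)) : ℝ :=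
  (1 / 2) * ∑ l, (metricCoeff L p)⁻¹ i l *
    (deltaX L j (fun q => metricCoeff L q l k) p + deltaX L k (fun q => metricCoeff L q j l) p
      - deltaX L l (fun q => metricCoeff L q j k) p)

/-- The Chern connection `D_ζ X` on `π*TM`, with connection forms `ω_jⁱ = Γⁱ_jk dxᵏ`. -/
def chernD (ζ : EuclideanSpace ℝ (Fin n) × EuclideanSpace ℝ (Fin n) →
      EuclideanSpace ℝ (Fin n) × EuclideanSpace ℝ (Fin n))
    (X : EuclideanSpace ℝ (Fin n) × EuclideanSpace ℝ (Fin n) → EuclideanSpace ℝ (Fin n))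
    (p : EuclideanSpace ℝ (Fin n) × EuclideanSpace ℝ (Fin n)) : EuclideanSpace ℝ (Fin n) :=
  fderiv ℝ X p (ζ p) +
    WithLp.toLp 2 (fun i => ∑ j, ∑ k, chernCoeff L i j k p * X p j * (ζ p).1 k)

/-- The Chern curvature
`R_jⁱ_kl = δΓⁱ_jl/δxᵏ - δΓⁱ_jk/δxˡ + Γⁱ_mk Γᵐ_jl - Γⁱ_ml Γᵐ_jk`. -/
def chernR (j i k l : Fin n)
    (p : EuclideanSpace ℝ (Fin n) × EuclideanSpace ℝ (Fin n)) : ℝ :=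
  deltaX L k (chernCoeff L i j l) p - deltaX L l (chernCoeff L i j k) p
    + (∑ m, chernCoeff L i m k p * chernCoeff L m j l p)
    - ∑ m, chernCoeff L i m l p * chernCoeff L m j k p

/-- The Landsberg tensor `P_jⁱ_kl = ∂Γⁱ_jk/∂yˡ`. -/
def landsbergP (j i k l : Fin n)
    (p : EuclideanSpace ℝ (Fin n) × EuclideanSpace ℝ (Fin n)) : ℝ :=
  dy l (chernCoeff L i j k) p

/-- The horizontal covariant derivative `Tⁱ_{|j} = δTⁱ/δxʲ + Tᵐ Γⁱ_mj` of a section of `π*TM`. -/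
def hcov (T : Fin n → EuclideanSpace ℝ (Fin n) × EuclideanSpace ℝ (Fin n) → ℝ) (i j : Fin n)
    (p : EuclideanSpace ℝ (Fin n) × EuclideanSpace ℝ (Fin n)) : ℝ :=
  deltaX L j (T i) p + ∑ m, T m p * chernCoeff L i m j p

/-- The horizontal covariant derivative `Tⁱ_{j|k} = δTⁱ_j/δxᵏ + Tᵐ_j Γⁱ_mk - Tⁱ_m Γᵐ_jk` of a
tensor of type `(1, 1)` on `π*TM`. -/
def hcov₁₁ (T : Fin n → Fin n → EuclideanSpace ℝ (Fin n) × EuclideanSpace ℝ (Fin n) → ℝ)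
    (i j k : Fin n) (p : EuclideanSpace ℝ (Fin n) × EuclideanSpace ℝ (Fin n)) : ℝ :=
  deltaX L k (T i j) p + (∑ m, T m j p * chernCoeff L i m k p)
    - ∑ m, T i m p * chernCoeff L m j k p

/-- The components `Vⁱ(x)` of a vector field on `M`, as those of the section `(x, y) ↦ V(x)` of
`π*TM`. -/
def pullbackComp (V : EuclideanSpace ℝ (Fin n) → EuclideanSpace ℝ (Fin n)) (i : Fin n)
    (p : EuclideanSpace ℝ (Fin n) × EuclideanSpace ℝ (Fin n)) : ℝ :=
  V p.1 i

/-- The complete lift `V̂ = Vⁱ ∂/∂xⁱ + yᵐ (∂Vⁱ/∂xᵐ) ∂/∂yⁱ`. -/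
def completeLift (V : EuclideanSpace ℝ (Fin n) → EuclideanSpace ℝ (Fin n))
    (p : EuclideanSpace ℝ (Fin n) × EuclideanSpace ℝ (Fin n)) :
    EuclideanSpace ℝ (Fin n) × EuclideanSpace ℝ (Fin n) :=
  (V p.1, fderiv ℝ V p.1 p.2)

/-- The bundle map `ρ : T(TM₀) → π*TM`, `ρ(∂/∂xⁱ) = ∂ᵢ`, `ρ(∂/∂yⁱ) = 0`, on vector fields. -/
def rho (ζ : EuclideanSpace ℝ (Fin n) × EuclideanSpace ℝ (Fin n) →
      EuclideanSpace ℝ (Fin n) × EuclideanSpace ℝ (Fin n))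
    (p : EuclideanSpace ℝ (Fin n) × EuclideanSpace ℝ (Fin n)) : EuclideanSpace ℝ (Fin n) :=
  (ζ p).1

/-- The horizontal lift `ℋ : π*TM → HTM`, `ℋ(∂ᵢ) = δ/δxⁱ = ∂/∂xⁱ - Nʲ_i ∂/∂yʲ`, on sections. -/
def horLift (X : EuclideanSpace ℝ (Fin n) × EuclideanSpace ℝ (Fin n) → EuclideanSpace ℝ (Fin n))
    (p : EuclideanSpace ℝ (Fin n) × EuclideanSpace ℝ (Fin n)) :
    EuclideanSpace ℝ (Fin n) × EuclideanSpace ℝ (Fin n) :=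
  (X p, WithLp.toLp 2 (fun j => -∑ i, nonlinCoeff L j i p * X p i))

/-- The Lie derivative `ℒ_V̂ X = ρ[V̂, X]` of a section `X` of `π*TM`, where `X` is regarded as
a horizontal vector field on `TM₀`. -/
def lieSection (V : EuclideanSpace ℝ (Fin n) → EuclideanSpace ℝ (Fin n))
    (X : EuclideanSpace ℝ (Fin n) × EuclideanSpace ℝ (Fin n) → EuclideanSpace ℝ (Fin n)) :
    EuclideanSpace ℝ (Fin n) × EuclideanSpace ℝ (Fin n) → EuclideanSpace ℝ (Fin n) :=
  rho (VectorField.lieBracket ℝ (completeLift V) (horLift L X))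

/-- The Lie derivative of the Chern connection,
`(ℒ_V̂ D)(ζ, X) = ℒ_V̂ (D_ζ X) - D_{[V̂, ζ]} X - D_ζ (ℒ_V̂ X)`. -/
def lieChernD (V : EuclideanSpace ℝ (Fin n) → EuclideanSpace ℝ (Fin n))
    (ζ : EuclideanSpace ℝ (Fin n) × EuclideanSpace ℝ (Fin n) →
      EuclideanSpace ℝ (Fin n) × EuclideanSpace ℝ (Fin n))
    (X : EuclideanSpace ℝ (Fin n) × EuclideanSpace ℝ (Fin n) → EuclideanSpace ℝ (Fin n))
    (p : EuclideanSpace ℝ (Fin n) × EuclideanSpace ℝ (Fin n)) : EuclideanSpace ℝ (Fin n) :=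
  lieSection L V (chernD L ζ X) p
    - chernD L (VectorField.lieBracket ℝ (completeLift V) ζ) X p
    - chernD L ζ (lieSection L V X) p

/-- The frame section `∂ᵢ` of `π*TM`. -/
def frame (i : Fin n) (_ : EuclideanSpace ℝ (Fin n) × EuclideanSpace ℝ (Fin n)) :
    EuclideanSpace ℝ (Fin n) :=
  EuclideanSpace.single i 1

/-- The components `ℒ_V̂ Γⁱ_jk` defined by `(ℒ_V̂ D)(∂_j, ∂_k) = (ℒ_V̂ Γⁱ_jk) ∂ᵢ`, the first
argument `∂_j` being regarded as the horizontal vector field `δ/δxʲ`. -/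
def lieChernCoeff (V : EuclideanSpace ℝ (Fin n) → EuclideanSpace ℝ (Fin n)) (i j k : Fin n)
    (p : EuclideanSpace ℝ (Fin n) × EuclideanSpace ℝ (Fin n)) : ℝ :=
  lieChernD L V (horLift L (frame j)) (frame k) p i

/-- The Chern connection coefficients are the unique solution of the structure equations of the
Chern connection: absence of torsion, and almost compatibility with the metric
`dg_ij - g_lj ω_iˡ - g_il ω_jˡ = 2 C_ijl δyˡ`, `ω_iˡ = Γˡ_ik dxᵏ`, which is its `dxᵏ` part
stated here (its `δyˡ` part is the definition of the Cartan tensor). -/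
theorem chernCoeff_unique (p : EuclideanSpace ℝ (Fin n) × EuclideanSpace ℝ (Fin n))
    (hsymm : ∀ᶠ q in nhds p, (metricCoeff L q).IsSymm) (hdet : IsUnit (metricCoeff L p).det)
    (A : Fin n → Fin n → Fin n → ℝ) :
    ((∀ i j k, A i j k = A i k j) ∧
      ∀ i j k, deltaX L k (fun q => metricCoeff L q i j) p =
        (∑ l, A l i k * metricCoeff L p l j) + ∑ l, A l j k * metricCoeff L p i l) ↔
    ∀ i j k, A i j k = chernCoeff L i j k p := by
  have hg : ∀ i j, metricCoeff L p i j = metricCoeff L p j i := fun i j =>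
    hsymm.self_of_nhds.apply j i
  have hd : ∀ i j k, deltaX L k (fun q => metricCoeff L q i j) p =
      deltaX L k (fun q => metricCoeff L q j i) p := by
    intro i j k
    have h : (fun q => metricCoeff L q i j) =ᶠ[nhds p] fun q => metricCoeff L q j i :=
      hsymm.mono fun q hq => hq.apply j i
    simp only [deltaX, dx, dy, h.fderiv_eq]
  set Q : Fin n → Fin n → Fin n → ℝ :=
    fun k i j => deltaX L k (fun q => metricCoeff L q i j) p with hQ
  have hQs : ∀ k i j, Q k i j = Q k j i := fun k i j => hd i j k
  -- Lowering the index of the coefficients.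
  have hlow : ∀ j k m, ∑ l, chernCoeff L l j k p * metricCoeff L p l m =
      (1 / 2) * (Q j m k + Q k j m - Q m j k) := by
    intro j k m
    set c : Fin n → ℝ := fun l => Q j l k + Q k j l - Q l j k with hc
    have h1 : ∀ l, chernCoeff L l j k p = (1 / 2) * ((metricCoeff L p)⁻¹.mulVec c) l := by
      intro l
      rfl
    have h2 : (metricCoeff L p).mulVec ((metricCoeff L p)⁻¹.mulVec c) = c := by
      rw [Matrix.mulVec_mulVec, Matrix.mul_nonsing_inv _ hdet, Matrix.one_mulVec]
    have h3 := congrFun h2 m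
    rw [Matrix.mulVec, dotProduct] at h3
    calc ∑ l, chernCoeff L l j k p * metricCoeff L p l m
        = (1 / 2) * ∑ l, metricCoeff L p m l * ((metricCoeff L p)⁻¹.mulVec c) l := by
          rw [Finset.mul_sum]
          refine Finset.sum_congr rfl fun l _ => ?_
          rw [h1, hg l m]
          ring
      _ = _ := by rw [h3]
  constructor
  · rintro ⟨hA, hcompat⟩ i j k
    have hc : ∀ i j k, Q k i j =
        (∑ l, A l i k * metricCoeff L p l j) + ∑ l, A l j k * metricCoeff L p l i := by
      intro i j k
      rw [hQ]
      refine (hcompat i j k).trans ?_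
      congr 1
      exact Finset.sum_congr rfl fun l _ => by rw [hg i l]
    have hsw : ∀ j k m, ∑ l, A l j k * metricCoeff L p l m =
        ∑ l, A l k j * metricCoeff L p l m := fun j k m =>
      Finset.sum_congr rfl fun l _ => by rw [hA l j k]
    have hAl : ∀ j k m, ∑ l, A l j k * metricCoeff L p l m =
        (1 / 2) * (Q j m k + Q k j m - Q m j k) := by
      intro j k m
      rw [hc m k j, hc j m k, hc j k m, hsw m j k, hsw k m j, hsw k j m, hsw m k j]
      ring
    have hvec : Matrix.vecMul (fun l => A l j k) (metricCoeff L p) =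
        Matrix.vecMul (fun l => chernCoeff L l j k p) (metricCoeff L p) := by
      funext m
      exact (hAl j k m).trans (hlow j k m).symm
    have hinj := Matrix.vecMul_injective_of_isUnit
      ((Matrix.isUnit_iff_isUnit_det (metricCoeff L p)).2 hdet)
    exact congrFun (hinj hvec) i
  · intro h
    refine ⟨fun i j k => ?_, fun i j k => ?_⟩
    · rw [h, h]
      simp only [chernCoeff]
      refine congrArg _ (Finset.sum_congr rfl fun l _ => ?_)
      rw [hd l k j, hd j l k, hd j k l]
      ring
    · simp only [h]
      have h2 : ∑ l, chernCoeff L l j k p * metricCoeff L p i l =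
          ∑ l, chernCoeff L l j k p * metricCoeff L p l i :=
        Finset.sum_congr rfl fun l _ => by rw [hg i l]
      rw [h2, hlow, hlow]
      change Q k i j = _
      rw [hQs k j i, hQs i j k, hQs j i k]
      ring

end Coordinates

end Finsler

end

/-! In coordinates the theorem is a comparison of terms. The bracket formulas turn the left side
into the classical expression of `lieChernCoeff_eq`: V̂(Γⁱ_jk) - Γᵐ_jk ∂ₘVⁱ + Γⁱ_km ∂ⱼVᵐ + Γⁱ_mj
∂ₖVᵐ + ∂ⱼ∂ₖVⁱ. The connection `N` does not appear explicitly in it, since `rho` keeps only the base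
component of a bracket and the connection forms vanish on vertical vectors.

Now split V̂ = Vᵐ δ/δxᵐ + (Vᵐ Nˡ_m + yᵐ ∂ₘVˡ) ∂/∂yˡ. The horizontal part, together with the
remaining terms, gives the curvature and the second covariant derivative, as for an affine
connection. The vertical coefficient is yᵐ Vˡ_{|m}, because Nˡ_s = Γˡ_sm yᵐ; applied to Γ it gives
the Landsberg term. `sum_lie_eq_sum_curvature` carries out this bookkeeping.

Besides regularity, only two properties of the Chern coefficients enter: symmetry in the lower
indices (`chernCoeff_comm`) and Γⁱ_jk yᵏ = Nⁱ_j (`sum_chernCoeff_mul`). The second rests on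
homogeneity: Euler's relation for F² makes the Cartan tensor annihilate y, and nondegeneracy of g
allows the identity to be checked with its index lowered. `isRegularOn_localMetric` derives both
inputs from the Finsler axioms. -/

noncomputable section

namespace Finsler

/-! ### Calculus on open sets of pairs (x, y). -/

section Smoothness

variable {n : ℕ} {U : Set (EuclideanSpace ℝ (Fin n) × EuclideanSpace ℝ (Fin n))}
  {f : EuclideanSpace ℝ (Fin n) × EuclideanSpace ℝ (Fin n) → ℝ}
  {p : EuclideanSpace ℝ (Fin n) × EuclideanSpace ℝ (Fin n)}

theorem contDiffOn_fderiv_apply (hU : IsOpen U) (hf : ContDiffOn ℝ ∞ f U)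
    (w : EuclideanSpace ℝ (Fin n) × EuclideanSpace ℝ (Fin n)) :
    ContDiffOn ℝ ∞ (fun q => fderiv ℝ f q w) U :=
  (hf.fderiv_of_isOpen hU (m := ∞) (by simp)).clm_apply contDiffOn_const

theorem contDiffOn_dx (hU : IsOpen U) (hf : ContDiffOn ℝ ∞ f U) (i : Fin n) :
    ContDiffOn ℝ ∞ (dx i f) U :=
  contDiffOn_fderiv_apply hU hf _

theorem contDiffOn_dy (hU : IsOpen U) (hf : ContDiffOn ℝ ∞ f U) (i : Fin n) :
    ContDiffOn ℝ ∞ (dy i f) U :=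
  contDiffOn_fderiv_apply hU hf _

theorem differentiableAt_of_contDiffOn (hU : IsOpen U) (hf : ContDiffOn ℝ ∞ f U) (hp : p ∈ U) :
    DifferentiableAt ℝ f p :=
  (hf.contDiffAt (hU.mem_nhds hp)).differentiableAt (by simp)

theorem contDiff_snd_coord (k : Fin n) :
    ContDiff ℝ ∞ fun q : EuclideanSpace ℝ (Fin n) × EuclideanSpace ℝ (Fin n) => q.2 k := by
  fun_prop

theorem fderiv_snd_coord (k : Fin n)
    (w : EuclideanSpace ℝ (Fin n) × EuclideanSpace ℝ (Fin n)) :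
    fderiv ℝ (fun q : EuclideanSpace ℝ (Fin n) × EuclideanSpace ℝ (Fin n) => q.2 k) p w
      = w.2 k := by
  have h : (fun q : EuclideanSpace ℝ (Fin n) × EuclideanSpace ℝ (Fin n) => q.2 k) =
      ((EuclideanSpace.proj k : EuclideanSpace ℝ (Fin n) →L[ℝ] ℝ).comp
        (ContinuousLinearMap.snd ℝ _ _)) := rfl
  rw [h, ContinuousLinearMap.fderiv]
  rfl

theorem fderiv_sum_mul_apply {E ι : Type*} [NormedAddCommGroup E] [NormedSpace ℝ E] [Fintype ι]
    {a b : ι → E → ℝ} {p : E} (ha : ∀ i, DifferentiableAt ℝ (a i) p)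
    (hb : ∀ i, DifferentiableAt ℝ (b i) p) (w : E) :
    fderiv ℝ (fun q => ∑ i, a i q * b i q) p w =
      ∑ i, (fderiv ℝ (a i) p w * b i p + a i p * fderiv ℝ (b i) p w) := by
  rw [fderiv_fun_sum fun i _ => (ha i).fun_mul (hb i)]
  simp only [FunLike.coe_sum, Finset.sum_apply]
  refine Finset.sum_congr rfl fun i _ => ?_
  rw [fderiv_fun_mul (ha i) (hb i)]
  simp [add_comm, mul_comm]

theorem fderiv_sum_mul_snd {a : Fin n → EuclideanSpace ℝ (Fin n) × EuclideanSpace ℝ (Fin n) → ℝ}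
    (ha : ∀ i, DifferentiableAt ℝ (a i) p)
    (w : EuclideanSpace ℝ (Fin n) × EuclideanSpace ℝ (Fin n)) :
    fderiv ℝ (fun q => ∑ s, a s q * q.2 s) p w =
      (∑ s, fderiv ℝ (a s) p w * p.2 s) + ∑ s, a s p * w.2 s := by
  rw [fderiv_sum_mul_apply ha fun s => (contDiff_snd_coord s).differentiable (by simp) p]
  simp only [fderiv_snd_coord, Finset.sum_add_distrib]

/-- The derivative of an identity `∑ₛ aₛ yˢ = b` that holds on an open set. -/
theorem sum_fderiv_mul_snd (hU : IsOpen U)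
    {a : Fin n → EuclideanSpace ℝ (Fin n) × EuclideanSpace ℝ (Fin n) → ℝ}
    (ha : ∀ i, ContDiffOn ℝ ∞ (a i) U) (h : ∀ q ∈ U, ∑ s, a s q * q.2 s = f q) (hp : p ∈ U)
    (w : EuclideanSpace ℝ (Fin n) × EuclideanSpace ℝ (Fin n)) :
    (∑ s, fderiv ℝ (a s) p w * p.2 s) + ∑ s, a s p * w.2 s = fderiv ℝ f p w := by
  rw [← fderiv_sum_mul_snd (fun i => differentiableAt_of_contDiffOn hU (ha i) hp)]
  have : (fun q => ∑ s, a s q * q.2 s) =ᶠ[nhds p] f :=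
    Filter.eventually_of_mem (hU.mem_nhds hp) h
  rw [this.fderiv_eq]

theorem fderiv_fderiv_apply {E F : Type*} [NormedAddCommGroup E] [NormedSpace ℝ E]
    [NormedAddCommGroup F] [NormedSpace ℝ F] {f : E → F} {p : E} (hf : ContDiffAt ℝ 2 f p)
    (v w : E) : fderiv ℝ (fun q => fderiv ℝ f q v) p w = fderiv ℝ (fderiv ℝ f) p w v := by
  have h : DifferentiableAt ℝ (fderiv ℝ f) p :=
    (hf.fderiv_right (m := 1) (by norm_num)).differentiableAt (by simp)
  rw [fderiv_clm_apply h (differentiableAt_const v)]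
  simp

/-- Assuming only C² at one point, and allowing vector values, makes this usable for V as well as
for F². -/
theorem fderiv_fderiv_apply_comm {E F : Type*} [NormedAddCommGroup E] [NormedSpace ℝ E]
    [NormedAddCommGroup F] [NormedSpace ℝ F] {f : E → F} {p : E} (hf : ContDiffAt ℝ 2 f p)
    (v w : E) : fderiv ℝ (fun q => fderiv ℝ f q v) p w = fderiv ℝ (fun q => fderiv ℝ f q w) p v := by
  rw [fderiv_fderiv_apply hf, fderiv_fderiv_apply hf]
  exact (hf.isSymmSndFDerivAt (by simp)) _ _

theorem contDiffAt_two_of_contDiffOn (hU : IsOpen U) (hf : ContDiffOn ℝ ∞ f U) (hp : p ∈ U) :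
    ContDiffAt ℝ 2 f p :=
  (hf.contDiffAt (hU.mem_nhds hp)).of_le (WithTop.coe_le_coe.2 (le_top : (2 : ℕ∞) ≤ ⊤))

theorem dy_dy_comm (hU : IsOpen U) (hf : ContDiffOn ℝ ∞ f U) (hp : p ∈ U) (i j : Fin n) :
    dy i (dy j f) p = dy j (dy i f) p :=
  fderiv_fderiv_apply_comm (contDiffAt_two_of_contDiffOn hU hf hp) _ _

theorem dx_dy_comm (hU : IsOpen U) (hf : ContDiffOn ℝ ∞ f U) (hp : p ∈ U) (i j : Fin n) :
    dx i (dy j f) p = dy j (dx i f) p :=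
  fderiv_fderiv_apply_comm (contDiffAt_two_of_contDiffOn hU hf hp) _ _

theorem fderiv_congr_on {g : EuclideanSpace ℝ (Fin n) × EuclideanSpace ℝ (Fin n) → ℝ}
    (hU : IsOpen U) (h : ∀ q ∈ U, f q = g q) (hp : p ∈ U) : fderiv ℝ f p = fderiv ℝ g p :=
  Filter.EventuallyEq.fderiv_eq (Filter.eventually_of_mem (hU.mem_nhds hp) h)

theorem contDiffOn_det {ι : Type*} [Fintype ι] [DecidableEq ι]
    {A : EuclideanSpace ℝ (Fin n) × EuclideanSpace ℝ (Fin n) → Matrix ι ι ℝ}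
    (hA : ∀ i j, ContDiffOn ℝ ∞ (fun q => A q i j) U) :
    ContDiffOn ℝ ∞ (fun q => (A q).det) U := by
  simp only [Matrix.det_apply']
  exact ContDiffOn.sum fun σ _ => contDiffOn_const.mul (contDiffOn_prod fun i _ => hA _ _)

/-- Cramer's rule: the entries of the inverse are determinants of row-updated matrices divided by
`det A`. -/
theorem contDiffOn_matrix_inv {ι : Type*} [Fintype ι] [DecidableEq ι]
    {A : EuclideanSpace ℝ (Fin n) × EuclideanSpace ℝ (Fin n) → Matrix ι ι ℝ}
    (hA : ∀ i j, ContDiffOn ℝ ∞ (fun q => A q i j) U) (hdet : ∀ q ∈ U, IsUnit (A q).det)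
    (i j : ι) : ContDiffOn ℝ ∞ (fun q => (A q)⁻¹ i j) U := by
  simp only [Matrix.inv_def, Matrix.smul_apply, Ring.inverse_eq_inv', smul_eq_mul,
    Matrix.adjugate_apply]
  refine ((contDiffOn_det hA).inv fun q hq => (hdet q hq).ne_zero).mul (contDiffOn_det ?_)
  intro k l
  simp only [Matrix.updateRow_apply]
  split_ifs
  · exact contDiffOn_const
  · exact hA k l

end Smoothness

/-! ### Homogeneity identities for the metric, the spray and the Chern coefficients. -/

/-- The regularity of the coordinate expression of a Finsler metric on an open set `U` of pairs
`(x, y)`: smoothness, nondegeneracy of the fundamental tensor, and Euler's relation for `F²`. -/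
structure IsRegularOn {n : ℕ} (L : EuclideanSpace ℝ (Fin n) × EuclideanSpace ℝ (Fin n) → ℝ)
    (U : Set (EuclideanSpace ℝ (Fin n) × EuclideanSpace ℝ (Fin n))) : Prop where
  isOpen : IsOpen U
  smooth : ContDiffOn ℝ ∞ (fun q => L q ^ 2) U
  isUnit_det : ∀ q ∈ U, IsUnit (metricCoeff L q).det
  euler : ∀ q ∈ U, ∑ s, dy s (fun q => L q ^ 2) q * q.2 s = 2 * L q ^ 2

namespace IsRegularOn

variable {n : ℕ} {L : EuclideanSpace ℝ (Fin n) × EuclideanSpace ℝ (Fin n) → ℝ}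
  {U : Set (EuclideanSpace ℝ (Fin n) × EuclideanSpace ℝ (Fin n))}
  {p : EuclideanSpace ℝ (Fin n) × EuclideanSpace ℝ (Fin n)}

theorem contDiffOn_metricCoeff (h : IsRegularOn L U) (i j : Fin n) :
    ContDiffOn ℝ ∞ (fun q => metricCoeff L q i j) U :=
  contDiffOn_const.mul (contDiffOn_dy h.isOpen (contDiffOn_dy h.isOpen h.smooth _) _)

theorem contDiffOn_metricCoeff_inv (h : IsRegularOn L U) (i j : Fin n) :
    ContDiffOn ℝ ∞ (fun q => (metricCoeff L q)⁻¹ i j) U :=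
  contDiffOn_matrix_inv h.contDiffOn_metricCoeff h.isUnit_det i j

theorem contDiffOn_sprayCoeff (h : IsRegularOn L U) (i : Fin n) :
    ContDiffOn ℝ ∞ (sprayCoeff L i) U := by
  refine contDiffOn_const.mul (ContDiffOn.sum fun l _ => (h.contDiffOn_metricCoeff_inv i l).mul
    ((ContDiffOn.sum fun k _ => ?_).sub (contDiffOn_dx h.isOpen h.smooth l)))
  exact (contDiffOn_dy h.isOpen (contDiffOn_dx h.isOpen h.smooth _) _).mul
    (contDiff_snd_coord k).contDiffOn

theorem contDiffOn_nonlinCoeff (h : IsRegularOn L U) (i j : Fin n) :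
    ContDiffOn ℝ ∞ (nonlinCoeff L i j) U :=
  contDiffOn_dy h.isOpen (h.contDiffOn_sprayCoeff i) j

theorem contDiffOn_deltaX (h : IsRegularOn L U)
    {f : EuclideanSpace ℝ (Fin n) × EuclideanSpace ℝ (Fin n) → ℝ} (hf : ContDiffOn ℝ ∞ f U)
    (i : Fin n) : ContDiffOn ℝ ∞ (deltaX L i f) U :=
  (contDiffOn_dx h.isOpen hf i).sub (ContDiffOn.sum fun j _ =>
    (h.contDiffOn_nonlinCoeff j i).mul (contDiffOn_dy h.isOpen hf j))

theorem contDiffOn_chernCoeff (h : IsRegularOn L U) (i j k : Fin n) :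
    ContDiffOn ℝ ∞ (chernCoeff L i j k) U :=
  contDiffOn_const.mul (ContDiffOn.sum fun l _ => (h.contDiffOn_metricCoeff_inv i l).mul
    (((h.contDiffOn_deltaX (h.contDiffOn_metricCoeff l k) j).add
      (h.contDiffOn_deltaX (h.contDiffOn_metricCoeff j l) k)).sub
      (h.contDiffOn_deltaX (h.contDiffOn_metricCoeff j k) l)))

theorem metricCoeff_comm (h : IsRegularOn L U) (hp : p ∈ U) (i j : Fin n) :
    metricCoeff L p i j = metricCoeff L p j i := by
  simp only [metricCoeff, Matrix.of_apply, dy_dy_comm h.isOpen h.smooth hp i j]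

theorem fderiv_metricCoeff_comm (h : IsRegularOn L U) (hp : p ∈ U) (i j : Fin n) :
    fderiv ℝ (fun q => metricCoeff L q i j) p = fderiv ℝ (fun q => metricCoeff L q j i) p :=
  fderiv_congr_on h.isOpen (fun _ hq => h.metricCoeff_comm hq i j) hp

theorem deltaX_metricCoeff_comm (h : IsRegularOn L U) (hp : p ∈ U) (i j k : Fin n) :
    deltaX L k (fun q => metricCoeff L q i j) p = deltaX L k (fun q => metricCoeff L q j i) p := by
  simp only [deltaX, dx, dy, h.fderiv_metricCoeff_comm hp i j]

theorem chernCoeff_comm (h : IsRegularOn L U) (hp : p ∈ U) (i j k : Fin n) :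
    chernCoeff L i j k p = chernCoeff L i k j p := by
  simp only [chernCoeff]
  refine congrArg _ (Finset.sum_congr rfl fun l _ => ?_)
  rw [h.deltaX_metricCoeff_comm hp l k, h.deltaX_metricCoeff_comm hp j l,
    h.deltaX_metricCoeff_comm hp j k]
  ring

/-- Differentiating Euler's relation in yⁱ produces one extra [F²]_{yⁱ} from the factor yˢ, which
lowers the 2 on the right to 1. -/
theorem sum_dy_dy_mul (h : IsRegularOn L U) (hp : p ∈ U) (i : Fin n) :
    ∑ s, dy s (dy i fun q => L q ^ 2) p * p.2 s = dy i (fun q => L q ^ 2) p := by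
  have h1 := sum_fderiv_mul_snd h.isOpen (fun s => contDiffOn_dy h.isOpen h.smooth s) h.euler hp
    (0, EuclideanSpace.single i 1)
  rw [fderiv_const_mul (differentiableAt_of_contDiffOn h.isOpen h.smooth hp)] at h1
  simp only [PiLp.single_apply, mul_ite, mul_one, mul_zero, Finset.sum_ite_eq',
    Finset.mem_univ, if_true, smul_apply, smul_eq_mul] at h1
  have h2 : ∀ s, dy s (dy i fun q => L q ^ 2) p = dy i (dy s fun q => L q ^ 2) p := fun s =>
    dy_dy_comm h.isOpen h.smooth hp s i
  simp only [h2]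
  simp only [dy] at h1 ⊢
  linarith

theorem sum_dx_dy_mul (h : IsRegularOn L U) (hp : p ∈ U) (i : Fin n) :
    ∑ s, dx i (dy s fun q => L q ^ 2) p * p.2 s = 2 * dx i (fun q => L q ^ 2) p := by
  have h1 := sum_fderiv_mul_snd h.isOpen (fun s => contDiffOn_dy h.isOpen h.smooth s) h.euler hp
    (EuclideanSpace.single i 1, 0)
  rw [fderiv_const_mul (differentiableAt_of_contDiffOn h.isOpen h.smooth hp)] at h1
  simpa [dx] using h1

theorem sum_metricCoeff_mul (h : IsRegularOn L U) (hp : p ∈ U) (i : Fin n) :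
    ∑ s, metricCoeff L p i s * p.2 s = (1 / 2) * dy i (fun q => L q ^ 2) p := by
  rw [← h.sum_dy_dy_mul hp, Finset.mul_sum]
  simp only [metricCoeff, Matrix.of_apply, mul_assoc]

/-- The Cartan tensor annihilates y: differentiating g_is yˢ = (1/2)[F²]_{yⁱ} in yˡ leaves g_il on
both sides, and it cancels. -/
theorem sum_dy_metricCoeff_mul (h : IsRegularOn L U) (hp : p ∈ U) (i l : Fin n) :
    ∑ s, dy l (fun q => metricCoeff L q i s) p * p.2 s = 0 := by
  have h1 := sum_fderiv_mul_snd h.isOpen (fun s => h.contDiffOn_metricCoeff i s)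
    (fun q hq => h.sum_metricCoeff_mul hq i) hp (0, EuclideanSpace.single l 1)
  rw [fderiv_const_mul (differentiableAt_of_contDiffOn h.isOpen
    (contDiffOn_dy h.isOpen h.smooth i) hp)] at h1
  simpa [metricCoeff, dy] using h1

/-- Both sides are half a third y-derivative of F². With the symmetry of g this is the total
symmetry of the Cartan tensor. -/
theorem dy_metricCoeff_comm (h : IsRegularOn L U) (hp : p ∈ U) (i j k : Fin n) :
    dy k (fun q => metricCoeff L q i j) p = dy j (fun q => metricCoeff L q i k) p := by
  have hd : ∀ a b, DifferentiableAt ℝ (dy a (dy b fun q => L q ^ 2)) p := fun a b =>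
    differentiableAt_of_contDiffOn h.isOpen
      (contDiffOn_dy h.isOpen (contDiffOn_dy h.isOpen h.smooth b) a) hp
  have h1 : ∀ a b c, dy c (fun q => metricCoeff L q a b) p =
      (1 / 2) * dy c (dy b (dy a fun q => L q ^ 2)) p := by
    intro a b c
    simp only [metricCoeff, Matrix.of_apply]
    rw [dy, fderiv_const_mul (hd b a)]
    rfl
  rw [h1, h1, dy_dy_comm h.isOpen (contDiffOn_dy h.isOpen h.smooth i) hp]

/-- The geodesic spray with its index lowered. -/
theorem sum_metricCoeff_mul_sprayCoeff (h : IsRegularOn L U) (hp : p ∈ U) (i : Fin n) :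
    ∑ l, metricCoeff L p i l * sprayCoeff L l p =
      (1 / 4) * ((∑ k, dy i (dx k fun q => L q ^ 2) p * p.2 k) - dx i (fun q => L q ^ 2) p) := by
  set c : Fin n → ℝ := fun l =>
    (1 / 4) * ((∑ k, dy l (dx k fun q => L q ^ 2) p * p.2 k) - dx l (fun q => L q ^ 2) p) with hc
  have h1 : (fun l => sprayCoeff L l p) = (metricCoeff L p)⁻¹.mulVec c := by
    funext l
    simp only [sprayCoeff, Matrix.mulVec, dotProduct, hc, Finset.mul_sum]
    exact Finset.sum_congr rfl fun _ _ => by ring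
  have h2 : (metricCoeff L p).mulVec (fun l => sprayCoeff L l p) = c := by
    rw [h1, Matrix.mulVec_mulVec, Matrix.mul_nonsing_inv _ (h.isUnit_det p hp), Matrix.one_mulVec]
  exact congrFun h2 i

/-- This is the yˢ-derivative of the lowered spray identity. Lowering first avoids differentiating
the inverse matrix. -/
theorem sum_metricCoeff_mul_nonlinCoeff (h : IsRegularOn L U) (hp : p ∈ U) (i s : Fin n) :
    (∑ l, dy s (fun q => metricCoeff L q i l) p * sprayCoeff L l p) +
        ∑ l, metricCoeff L p i l * nonlinCoeff L l s p =
      (1 / 4) * ((∑ k, dy s (dy i (dx k fun q => L q ^ 2)) p * p.2 k)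
        + dy i (dx s fun q => L q ^ 2) p - dy s (dx i fun q => L q ^ 2) p) := by
  have hc : ∀ k, DifferentiableAt ℝ (dy i (dx k fun q => L q ^ 2)) p := fun k =>
    differentiableAt_of_contDiffOn h.isOpen
      (contDiffOn_dy h.isOpen (contDiffOn_dx h.isOpen h.smooth k) i) hp
  have hy : ∀ k : Fin n, DifferentiableAt ℝ
      (fun q : EuclideanSpace ℝ (Fin n) × EuclideanSpace ℝ (Fin n) => q.2 k) p := fun k =>
    (contDiff_snd_coord k).differentiable (by simp) p
  have hs : DifferentiableAt ℝ (fun q => ∑ k, dy i (dx k fun q => L q ^ 2) q * q.2 k) p :=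
    DifferentiableAt.fun_sum fun k _ => (hc k).fun_mul (hy k)
  have hd : DifferentiableAt ℝ (dx i fun q => L q ^ 2) p :=
    differentiableAt_of_contDiffOn h.isOpen (contDiffOn_dx h.isOpen h.smooth i) hp
  have h1 := congrArg (fun A => A (0, EuclideanSpace.single s 1)) (fderiv_congr_on
    h.isOpen (fun q hq => h.sum_metricCoeff_mul_sprayCoeff hq i) hp)
  beta_reduce at h1
  rw [fderiv_sum_mul_apply
    (fun l => differentiableAt_of_contDiffOn h.isOpen (h.contDiffOn_metricCoeff i l) hp)
    (fun l => differentiableAt_of_contDiffOn h.isOpen (h.contDiffOn_sprayCoeff l) hp),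
    Finset.sum_add_distrib, fderiv_const_mul (hs.fun_sub hd), smul_apply, fderiv_fun_sub hs hd,
    sub_apply, fderiv_sum_mul_snd hc] at h1
  simpa [nonlinCoeff, dy] using h1

/-- Nondegeneracy of g reduces an identity with an upper index to its lowered form. -/
theorem eq_of_sum_metricCoeff_mul_eq (h : IsRegularOn L U) (hp : p ∈ U) {u v : Fin n → ℝ}
    (huv : ∀ i, ∑ l, metricCoeff L p i l * u l = ∑ l, metricCoeff L p i l * v l) : u = v :=
  Matrix.mulVec_injective_of_isUnit
    ((Matrix.isUnit_iff_isUnit_det (metricCoeff L p)).2 (h.isUnit_det p hp)) (funext huv)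

theorem dx_dy_dy_eq (h : IsRegularOn L U) (hp : p ∈ U) (i k s : Fin n) :
    dy s (dy i (dx k fun q => L q ^ 2)) p = dx k (dy s (dy i fun q => L q ^ 2)) p := by
  rw [dx_dy_comm h.isOpen (contDiffOn_dy h.isOpen h.smooth i) hp]
  simp only [dy]
  rw [fderiv_congr_on h.isOpen (fun q hq => (dx_dy_comm h.isOpen h.smooth hq k i).symm) hp]

/-- Euler's relation for the spray coefficients, which have degree two. -/
theorem sum_nonlinCoeff_mul (h : IsRegularOn L U) (hp : p ∈ U) (l : Fin n) :
    ∑ s, nonlinCoeff L l s p * p.2 s = 2 * sprayCoeff L l p := by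
  refine congrFun (h.eq_of_sum_metricCoeff_mul_eq hp
    (u := fun l => ∑ s, nonlinCoeff L l s p * p.2 s) (v := fun l => 2 * sprayCoeff L l p)
    fun i => ?_) l
  have hN : ∀ s, ∑ l, metricCoeff L p i l * nonlinCoeff L l s p =
      (1 / 4) * ((∑ k, dx k (dy s (dy i fun q => L q ^ 2)) p * p.2 k)
        + dx s (dy i fun q => L q ^ 2) p - dx i (dy s fun q => L q ^ 2) p)
      - ∑ l, dy s (fun q => metricCoeff L q i l) p * sprayCoeff L l p := by
    intro s
    have := h.sum_metricCoeff_mul_nonlinCoeff hp i s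
    simp only [h.dx_dy_dy_eq hp, ← dx_dy_comm h.isOpen h.smooth hp] at this
    linarith
  have hG := h.sum_metricCoeff_mul_sprayCoeff hp i
  simp only [← dx_dy_comm h.isOpen h.smooth hp] at hG
  -- [F²]_{yⁱ} has degree one; its Euler relation is differentiated in xᵏ, where y is constant.
  have h3 : ∀ k, ∑ s, dx k (dy s (dy i fun q => L q ^ 2)) p * p.2 s =
      dx k (dy i fun q => L q ^ 2) p := by
    intro k
    have h1 := sum_fderiv_mul_snd h.isOpen (fun s => contDiffOn_dy h.isOpen
      (contDiffOn_dy h.isOpen h.smooth i) s) (fun q hq => h.sum_dy_dy_mul hq i) hp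
      (EuclideanSpace.single k 1, 0)
    simpa [dx] using h1
  -- By symmetry of the Cartan tensor the contraction with yˢ can be moved onto an index of g, where
  -- it vanishes.
  have h4 : ∑ s, (∑ l, dy s (fun q => metricCoeff L q i l) p * sprayCoeff L l p) * p.2 s = 0 := by
    simp only [Finset.sum_mul]
    rw [Finset.sum_comm]
    refine Finset.sum_eq_zero fun l _ => ?_
    have := h.sum_dy_metricCoeff_mul hp i l
    calc _ = sprayCoeff L l p * ∑ s, dy l (fun q => metricCoeff L q i s) p * p.2 s := by
          rw [Finset.mul_sum]
          refine Finset.sum_congr rfl fun s _ => ?_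
          rw [h.dy_metricCoeff_comm hp i l s]
          ring
      _ = 0 := by rw [this, mul_zero]
  have h5 : ∑ s, (∑ k, dx k (dy s (dy i fun q => L q ^ 2)) p * p.2 k) * p.2 s =
      ∑ k, dx k (dy i fun q => L q ^ 2) p * p.2 k := by
    simp only [← h3, Finset.sum_mul]
    rw [Finset.sum_comm]
    exact Finset.sum_congr rfl fun _ _ => Finset.sum_congr rfl fun _ _ => by ring
  calc ∑ l, metricCoeff L p i l * ∑ s, nonlinCoeff L l s p * p.2 s
      = ∑ s, (∑ l, metricCoeff L p i l * nonlinCoeff L l s p) * p.2 s := by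
        simp only [Finset.mul_sum, Finset.sum_mul]
        rw [Finset.sum_comm]
        exact Finset.sum_congr rfl fun _ _ => Finset.sum_congr rfl fun _ _ => by ring
    _ = (1 / 4) * ((∑ s, (∑ k, dx k (dy s (dy i fun q => L q ^ 2)) p * p.2 k) * p.2 s)
          + (∑ s, dx s (dy i fun q => L q ^ 2) p * p.2 s)
          - ∑ s, dx i (dy s fun q => L q ^ 2) p * p.2 s)
        - ∑ s, (∑ l, dy s (fun q => metricCoeff L q i l) p * sprayCoeff L l p) * p.2 s := by
        simp only [hN, sub_mul, Finset.sum_sub_distrib, mul_add, mul_sub, add_mul, mul_assoc,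
          Finset.sum_add_distrib, ← Finset.mul_sum]
    _ = 2 * ∑ l, metricCoeff L p i l * sprayCoeff L l p := by
        rw [h5, h4, h.sum_dx_dy_mul hp, hG]
        ring
    _ = _ := by
        rw [Finset.mul_sum]
        exact Finset.sum_congr rfl fun _ _ => by ring

theorem sum_metricCoeff_mul_chernCoeff (h : IsRegularOn L U) (hp : p ∈ U) (i j k : Fin n) :
    ∑ l, metricCoeff L p i l * chernCoeff L l j k p =
      (1 / 2) * (deltaX L j (fun q => metricCoeff L q i k) p
        + deltaX L k (fun q => metricCoeff L q j i) p
        - deltaX L i (fun q => metricCoeff L q j k) p) := by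
  set c : Fin n → ℝ := fun l => (1 / 2) * (deltaX L j (fun q => metricCoeff L q l k) p
    + deltaX L k (fun q => metricCoeff L q j l) p
    - deltaX L l (fun q => metricCoeff L q j k) p) with hc
  have h1 : (fun l => chernCoeff L l j k p) = (metricCoeff L p)⁻¹.mulVec c := by
    funext l
    simp only [chernCoeff, Matrix.mulVec, dotProduct, hc, Finset.mul_sum]
    exact Finset.sum_congr rfl fun _ _ => by ring
  have h2 : (metricCoeff L p).mulVec (fun l => chernCoeff L l j k p) = c := by
    rw [h1, Matrix.mulVec_mulVec, Matrix.mul_nonsing_inv _ (h.isUnit_det p hp), Matrix.one_mulVec]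
  exact congrFun h2 i

/-- `(δg_im/δxˢ) yᵐ = (1/2) ∂²F²/∂xˢ∂yⁱ`. -/
theorem sum_deltaX_metricCoeff_mul (h : IsRegularOn L U) (hp : p ∈ U) (i s : Fin n) :
    ∑ m, deltaX L s (fun q => metricCoeff L q i m) p * p.2 m =
      (1 / 2) * dx s (dy i fun q => L q ^ 2) p := by
  have h1 : ∑ m, dx s (fun q => metricCoeff L q i m) p * p.2 m =
      (1 / 2) * dx s (dy i fun q => L q ^ 2) p := by
    have h1 := sum_fderiv_mul_snd h.isOpen (fun s => h.contDiffOn_metricCoeff i s)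
      (fun q hq => h.sum_metricCoeff_mul hq i) hp (EuclideanSpace.single s 1, 0)
    rw [fderiv_const_mul (differentiableAt_of_contDiffOn h.isOpen
      (contDiffOn_dy h.isOpen h.smooth i) hp)] at h1
    simpa [dx] using h1
  simp only [deltaX, sub_mul, Finset.sum_sub_distrib, h1, Finset.sum_mul]
  -- The correction Nˡ_s (∂g_im/∂yˡ) yᵐ vanishes because the Cartan tensor annihilates y.
  rw [Finset.sum_comm, sub_eq_self]
  refine Finset.sum_eq_zero fun l _ => ?_
  simp only [mul_assoc, ← Finset.mul_sum, h.sum_dy_metricCoeff_mul hp, mul_zero]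

/-- The Chern connection induces the nonlinear connection: `Γⁱ_jk yᵏ = Nⁱ_j`. -/
theorem sum_chernCoeff_mul (h : IsRegularOn L U) (hp : p ∈ U) (l s : Fin n) :
    ∑ m, chernCoeff L l s m p * p.2 m = nonlinCoeff L l s p := by
  refine congrFun (h.eq_of_sum_metricCoeff_mul_eq hp
    (u := fun l => ∑ m, chernCoeff L l s m p * p.2 m) (v := fun l => nonlinCoeff L l s p)
    fun i => ?_) l
  have hN := h.sum_metricCoeff_mul_nonlinCoeff hp i s
  simp only [h.dx_dy_dy_eq hp, ← dx_dy_comm h.isOpen h.smooth hp] at hN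
  -- Here y contracts the direction of differentiation, so the correction survives: Nˡ_m yᵐ = 2Gˡ
  -- produces the same Cartan–spray term as in `hN`.
  have h1 : ∑ m, deltaX L m (fun q => metricCoeff L q s i) p * p.2 m =
      (∑ m, dx m (fun q => metricCoeff L q i s) p * p.2 m) -
        2 * ∑ l, dy s (fun q => metricCoeff L q i l) p * sprayCoeff L l p := by
    simp only [h.deltaX_metricCoeff_comm hp s i]
    simp only [deltaX, sub_mul, Finset.sum_sub_distrib,
      Finset.sum_mul]
    rw [Finset.sum_comm, Finset.mul_sum]
    congr 1
    refine Finset.sum_congr rfl fun l _ => ?_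
    rw [h.dy_metricCoeff_comm hp i s l]
    calc _ = dy s (fun q => metricCoeff L q i l) p * ∑ m, nonlinCoeff L l m p * p.2 m := by
          rw [Finset.mul_sum]
          exact Finset.sum_congr rfl fun _ _ => by ring
      _ = _ := by rw [h.sum_nonlinCoeff_mul hp]; ring
  have h2 : ∀ m, dx m (fun q => metricCoeff L q i s) p =
      (1 / 2) * dx m (dy s (dy i fun q => L q ^ 2)) p := by
    intro m
    simp only [metricCoeff, Matrix.of_apply]
    rw [dx, fderiv_const_mul (differentiableAt_of_contDiffOn h.isOpen
      (contDiffOn_dy h.isOpen (contDiffOn_dy h.isOpen h.smooth i) s) hp)]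
    rfl
  calc ∑ l, metricCoeff L p i l * ∑ m, chernCoeff L l s m p * p.2 m
      = ∑ m, (∑ l, metricCoeff L p i l * chernCoeff L l s m p) * p.2 m := by
        simp only [Finset.mul_sum, Finset.sum_mul]
        rw [Finset.sum_comm]
        exact Finset.sum_congr rfl fun _ _ => Finset.sum_congr rfl fun _ _ => by ring
    _ = (1 / 2) * ((∑ m, deltaX L s (fun q => metricCoeff L q i m) p * p.2 m)
          + (∑ m, deltaX L m (fun q => metricCoeff L q s i) p * p.2 m)
          - ∑ m, deltaX L i (fun q => metricCoeff L q s m) p * p.2 m) := by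
        simp only [h.sum_metricCoeff_mul_chernCoeff hp, sub_mul, Finset.sum_sub_distrib, mul_add,
          mul_sub, add_mul, mul_assoc, Finset.sum_add_distrib, ← Finset.mul_sum]
    _ = _ := by
        rw [h.sum_deltaX_metricCoeff_mul hp, h.sum_deltaX_metricCoeff_mul hp, h1]
        simp only [h2, mul_assoc, ← Finset.mul_sum]
        linarith

end IsRegularOn

/-! ### The Lie derivative and the covariant derivatives in components. -/

section Components

variable {n : ℕ}

theorem sum_smul_single (v : EuclideanSpace ℝ (Fin n)) :
    ∑ m, v m • (EuclideanSpace.single m 1 : EuclideanSpace ℝ (Fin n)) = v := by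
  ext a
  simp [Pi.single_apply]

theorem map_eq_sum_single {F : Type*} [NormedAddCommGroup F] [NormedSpace ℝ F]
    (A : EuclideanSpace ℝ (Fin n) →L[ℝ] F) (v : EuclideanSpace ℝ (Fin n)) :
    A v = ∑ m, v m • A (EuclideanSpace.single m 1) := by
  conv_lhs => rw [← sum_smul_single v]
  simp only [map_sum, map_smul]

theorem fderiv_eq_sum_dx_dy (f : EuclideanSpace ℝ (Fin n) × EuclideanSpace ℝ (Fin n) → ℝ)
    (p w : EuclideanSpace ℝ (Fin n) × EuclideanSpace ℝ (Fin n)) :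
    fderiv ℝ f p w = (∑ m, w.1 m * dx m f p) + ∑ m, w.2 m * dy m f p := by
  have h : w = (w.1, 0) + (0, w.2) := by simp
  rw [h, map_add]
  have h1 := map_eq_sum_single ((fderiv ℝ f p).comp (ContinuousLinearMap.inl ℝ _ _)) w.1
  have h2 := map_eq_sum_single ((fderiv ℝ f p).comp (ContinuousLinearMap.inr ℝ _ _)) w.2
  simp only [ContinuousLinearMap.comp_apply, ContinuousLinearMap.inl_apply,
    ContinuousLinearMap.inr_apply, smul_eq_mul] at h1 h2
  rw [h1, h2]
  simp [dx, dy]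

theorem fderiv_coord {E : Type*} [NormedAddCommGroup E] [NormedSpace ℝ E]
    {X : E → EuclideanSpace ℝ (Fin n)} {p : E} (hX : DifferentiableAt ℝ X p) (i : Fin n) (w : E) :
    fderiv ℝ (fun q => X q i) p w = fderiv ℝ X p w i := by
  have h := ((EuclideanSpace.proj i : EuclideanSpace ℝ (Fin n) →L[ℝ] ℝ).hasFDerivAt.comp p
    hX.hasFDerivAt).fderiv
  have h2 : (fun q => X q i) = (EuclideanSpace.proj i : EuclideanSpace ℝ (Fin n) →L[ℝ] ℝ) ∘ X := rfl
  rw [h2, h]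
  rfl

theorem fderiv_comp_fst {E F G : Type*} [NormedAddCommGroup E] [NormedSpace ℝ E]
    [NormedAddCommGroup F] [NormedSpace ℝ F] [NormedAddCommGroup G] [NormedSpace ℝ G]
    {f : E → G} {p : E × F} (hf : DifferentiableAt ℝ f p.1) (w : E × F) :
    fderiv ℝ (fun q : E × F => f q.1) p w = fderiv ℝ f p.1 w.1 := by
  have h := (hf.hasFDerivAt.comp p hasFDerivAt_fst).fderiv
  exact congrArg (fun A => A w) h

variable {L : EuclideanSpace ℝ (Fin n) × EuclideanSpace ℝ (Fin n) → ℝ}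
  {p : EuclideanSpace ℝ (Fin n) × EuclideanSpace ℝ (Fin n)}
  {V : EuclideanSpace ℝ (Fin n) → EuclideanSpace ℝ (Fin n)}

theorem horLift_frame (i : Fin n) : horLift L (frame i) p =
    (EuclideanSpace.single i 1, WithLp.toLp 2 fun j => -nonlinCoeff L j i p) := by
  simp [horLift, frame, PiLp.single_apply]

/-- As a directional derivative, δ/δxⁱ inherits the congruence, sum and product rules of `fderiv`.
-/
theorem deltaX_eq_fderiv (f : EuclideanSpace ℝ (Fin n) × EuclideanSpace ℝ (Fin n) → ℝ)
    (i : Fin n) : deltaX L i f p = fderiv ℝ f p (horLift L (frame i) p) := by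
  rw [fderiv_eq_sum_dx_dy, horLift_frame]
  simp [deltaX, PiLp.single_apply, sub_eq_add_neg]

theorem differentiableAt_completeLift (hV : ContDiffAt ℝ 2 V p.1) :
    DifferentiableAt ℝ (completeLift V) p := by
  have h1 : DifferentiableAt ℝ V p.1 := hV.differentiableAt (by simp)
  have h2 : DifferentiableAt ℝ (fderiv ℝ V) p.1 :=
    (hV.fderiv_right (m := 1) (by norm_num)).differentiableAt (by simp)
  exact (h1.comp p differentiableAt_fst).prodMk
    ((h2.comp p differentiableAt_fst).clm_apply differentiableAt_snd)

/-- The frame has constant components, so only the connection term remains. It sees ζ through its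
base component alone, hence [V̂, δ/δxʲ] matters only through `rho`. -/
theorem chernD_frame (ζ : EuclideanSpace ℝ (Fin n) × EuclideanSpace ℝ (Fin n) →
      EuclideanSpace ℝ (Fin n) × EuclideanSpace ℝ (Fin n)) (k : Fin n) :
    chernD L ζ (frame k) p = WithLp.toLp 2 fun i => ∑ b, chernCoeff L i k b p * (ζ p).1 b := by
  have h : fderiv ℝ (frame k) p = 0 := fderiv_const_apply _
  rw [chernD, h]
  ext i
  simp only [zero_apply, zero_add, frame, PiLp.single_apply]
  rw [Finset.sum_eq_single k (by intro b _ hb; simp [hb]) (by simp)]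
  simp

/-- The rearrangement of sums behind `IsRegularOn.lieChernCoeff_eq_curvature`. -/
theorem sum_lie_eq_sum_curvature (G : Fin n → Fin n → Fin n → ℝ)
    (hG : ∀ a b c, G a b c = G a c b) (v y P A B : Fin n → ℝ) (d : Fin n → Fin n → ℝ) (H : ℝ)
    (i j k : Fin n) :
    (∑ m, v m * (A m + ∑ l, (∑ s, G l m s * y s) * P l)) + (∑ l, (∑ m, y m * d m l) * P l)
        - (∑ m, G m k j * d m i) + (∑ m, G i k m * d j m) + H + ∑ m, G i m j * d k m =
      (∑ m, (A m - B m + (∑ s, G i s m * G s j k) - ∑ s, G i s k * G s j m) * v m)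
      + (H + (∑ m, (d k m * G i m j + v m * B m))
        + (∑ m, (d j m + ∑ s, v s * G m s j) * G i m k)
        - ∑ m, (d m i + ∑ s, v s * G i s m) * G m j k)
      + ∑ m, ∑ l, y m * (d m l + ∑ s, v s * G l s m) * P l := by
  -- `e1` and `e2` cancel the two quadratic terms of the curvature against those of V_{|j|k}.
  have e1 : ∑ m, ∑ s, G i s m * G s j k * v m = ∑ m, ∑ s, v s * G i s m * G m j k := by
    rw [Finset.sum_comm]
    exact Finset.sum_congr rfl fun m _ => Finset.sum_congr rfl fun s _ => by rw [hG i m s]; ring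
  have e2 : ∑ m, ∑ s, G i s k * G s j m * v m = ∑ m, ∑ s, v s * G m s j * G i m k := by
    rw [Finset.sum_comm]
    exact Finset.sum_congr rfl fun m _ => Finset.sum_congr rfl fun s _ => by rw [hG m s j]; ring
  have e3 : ∑ l, ∑ m, y m * d m l * P l = ∑ m, ∑ l, y m * d m l * P l := Finset.sum_comm
  -- The term Vᵐ Nˡ_m, with N written as Γ contracted with y, is the connection part of yᵐ Vˡ_{|m}.
  have e4 : ∑ m, ∑ l, ∑ s, v m * (G l m s * y s * P l) =
      ∑ m, ∑ l, ∑ s, y m * (v s * G l s m) * P l := by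
    rw [Finset.sum_comm]
    conv_rhs => rw [Finset.sum_comm]
    refine Finset.sum_congr rfl fun l _ => ?_
    rw [Finset.sum_comm]
    exact Finset.sum_congr rfl fun m _ => Finset.sum_congr rfl fun s _ => by ring
  have e5 : ∑ m, G m k j * d m i = ∑ m, d m i * G m j k :=
    Finset.sum_congr rfl fun m _ => by rw [hG m k j]; ring
  have e6 : ∑ m, G i k m * d j m = ∑ m, d j m * G i m k :=
    Finset.sum_congr rfl fun m _ => by rw [hG i k m]; ring
  have e7 : ∑ m, G i m j * d k m = ∑ m, d k m * G i m j :=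
    Finset.sum_congr rfl fun m _ => by ring
  have e8 : ∑ m, v m * A m = ∑ m, A m * v m := Finset.sum_congr rfl fun m _ => by ring
  have e9 : ∑ m, v m * B m = ∑ m, B m * v m := Finset.sum_congr rfl fun m _ => by ring
  simp only [add_mul, sub_mul, mul_add, Finset.sum_add_distrib, Finset.sum_sub_distrib,
    Finset.sum_mul, Finset.mul_sum]
  linarith

namespace IsRegularOn

variable {U : Set (EuclideanSpace ℝ (Fin n) × EuclideanSpace ℝ (Fin n))}

theorem differentiableAt_horLift (h : IsRegularOn L U) (hp : p ∈ U)
    {X : EuclideanSpace ℝ (Fin n) × EuclideanSpace ℝ (Fin n) → EuclideanSpace ℝ (Fin n)}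
    (hX : DifferentiableAt ℝ X p) : DifferentiableAt ℝ (horLift L X) p := by
  refine hX.prodMk ?_
  rw [differentiableAt_euclidean]
  intro j
  refine DifferentiableAt.neg (DifferentiableAt.fun_sum fun i _ => DifferentiableAt.mul ?_ ?_)
  · exact differentiableAt_of_contDiffOn h.isOpen (h.contDiffOn_nonlinCoeff j i) hp
  · exact differentiableAt_euclidean.1 hX i

/-- The base components of the two fields are V(x) and X, and V(x) does not depend on y; so the base
component of the bracket involves neither N nor the fibre part of X's lift. -/
theorem lieSection_apply (h : IsRegularOn L U) (hp : p ∈ U) (hV : ContDiffAt ℝ 2 V p.1)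
    {X : EuclideanSpace ℝ (Fin n) × EuclideanSpace ℝ (Fin n) → EuclideanSpace ℝ (Fin n)}
    (hX : DifferentiableAt ℝ X p) :
    lieSection L V X p = fderiv ℝ X p (completeLift V p) - fderiv ℝ V p.1 (X p) := by
  have h1 := fderiv.fst (h.differentiableAt_horLift hp hX)
  have h2 := fderiv.fst (differentiableAt_completeLift hV)
  have h3 := fderiv_comp_fst (F := EuclideanSpace ℝ (Fin n))
    (hV.differentiableAt (by simp)) (horLift L X p)
  rw [lieSection, rho, VectorField.lieBracket, Prod.fst_sub]
  congr 1
  · exact (congrArg (fun A => A (completeLift V p)) h1).symm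
  · exact ((congrArg (fun A => A (horLift L X p)) h2).symm.trans h3)

theorem lieSection_frame (h : IsRegularOn L U) (hp : p ∈ U) (hV : ContDiffAt ℝ 2 V p.1)
    (k : Fin n) :
    lieSection L V (frame k) p = -fderiv ℝ V p.1 (EuclideanSpace.single k 1) := by
  have hc : fderiv ℝ (frame k) p = 0 := fderiv_const_apply _
  rw [h.lieSection_apply hp hV (X := frame k) (differentiableAt_const _), hc]
  simp [frame]

/-- Pointwise formulas that are to be differentiated again must hold on a neighbourhood. -/
theorem eventually_contDiffAt (h : IsRegularOn L U) (hp : p ∈ U) (hV : ContDiffAt ℝ 2 V p.1) :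
    ∀ᶠ q in nhds p, q ∈ U ∧ ContDiffAt ℝ 2 V q.1 :=
  (h.isOpen.eventually_mem hp).and (continuousAt_fst.eventually (hV.eventually (by simp)))

theorem lieSection_chernD_apply (h : IsRegularOn L U) (hp : p ∈ U) (hV : ContDiffAt ℝ 2 V p.1)
    (i j k : Fin n) :
    lieSection L V (chernD L (horLift L (frame j)) (frame k)) p i =
      fderiv ℝ (chernCoeff L i k j) p (completeLift V p) -
        ∑ m, chernCoeff L m k j p * fderiv ℝ V p.1 (EuclideanSpace.single m 1) i := by
  have h1 : chernD L (horLift L (frame j)) (frame k) =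
      fun q => WithLp.toLp 2 fun i => chernCoeff L i k j q := by
    funext q
    rw [chernD_frame, horLift_frame]
    simp [PiLp.single_apply]
  have hd : DifferentiableAt ℝ (fun q => WithLp.toLp 2 fun i => chernCoeff L i k j q) p := by
    rw [differentiableAt_euclidean]
    exact fun a => differentiableAt_of_contDiffOn h.isOpen (h.contDiffOn_chernCoeff a k j) hp
  rw [h1, h.lieSection_apply hp hV hd, PiLp.sub_apply, ← fderiv_coord hd, map_eq_sum_single]
  simp

/-- Near p the section ℒ_V̂ ∂ₖ equals -∂ₖV, which depends on x only; its derivative along δ/δxʲ is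
therefore the plain xʲ-derivative. -/
theorem chernD_lieSection_frame_apply (h : IsRegularOn L U) (hp : p ∈ U)
    (hV : ContDiffAt ℝ 2 V p.1) (i j k : Fin n) :
    chernD L (horLift L (frame j)) (lieSection L V (frame k)) p i =
      -(fderiv ℝ (fun x => fderiv ℝ V x (EuclideanSpace.single k 1)) p.1
          (EuclideanSpace.single j 1) i
        + ∑ a, chernCoeff L i a j p * fderiv ℝ V p.1 (EuclideanSpace.single k 1) a) := by
  have h1 : lieSection L V (frame k) =ᶠ[nhds p]
      fun q => -fderiv ℝ V q.1 (EuclideanSpace.single k 1) :=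
    (h.eventually_contDiffAt hp hV).mono fun q hq => h.lieSection_frame hq.1 hq.2 k
  have hd : DifferentiableAt ℝ (fun x => fderiv ℝ V x (EuclideanSpace.single k 1)) p.1 :=
    ((hV.fderiv_right (m := 1) (by norm_num)).differentiableAt (by simp)).clm_apply
      (differentiableAt_const _)
  rw [chernD, h1.fderiv_eq, h1.self_of_nhds, fderiv_fun_neg, neg_apply,
    fderiv_comp_fst (f := fun x => fderiv ℝ V x (EuclideanSpace.single k 1)) hd, horLift_frame]
  simp [PiLp.single_apply]
  ring

/-- The Lie derivative of the Chern connection in terms of partial derivatives. -/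
theorem lieChernCoeff_eq (h : IsRegularOn L U) (hp : p ∈ U) (hV : ContDiffAt ℝ 2 V p.1)
    (i j k : Fin n) :
    lieChernCoeff L V i j k p =
      fderiv ℝ (chernCoeff L i k j) p (completeLift V p)
        - (∑ m, chernCoeff L m k j p * fderiv ℝ V p.1 (EuclideanSpace.single m 1) i)
        + (∑ m, chernCoeff L i k m p * fderiv ℝ V p.1 (EuclideanSpace.single j 1) m)
        + fderiv ℝ (fun x => fderiv ℝ V x (EuclideanSpace.single k 1)) p.1
          (EuclideanSpace.single j 1) i
        + ∑ m, chernCoeff L i m j p * fderiv ℝ V p.1 (EuclideanSpace.single k 1) m := by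
  have h1 : (VectorField.lieBracket ℝ (completeLift V) (horLift L (frame j)) p).1 =
      -- By definition the base component of this bracket is ℒ_V̂ ∂ⱼ.
      -fderiv ℝ V p.1 (EuclideanSpace.single j 1) := h.lieSection_frame hp hV j
  rw [lieChernCoeff, lieChernD, PiLp.sub_apply, PiLp.sub_apply,
    h.lieSection_chernD_apply hp hV, h.chernD_lieSection_frame_apply hp hV, chernD_frame, h1]
  simp
  ring

/-- V does not depend on y, so δ/δxᵇ acts on it as ∂/∂xᵇ. -/
theorem hcov_pullbackComp (hV : ContDiffAt ℝ 2 V p.1) (a b : Fin n) :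
    hcov L (pullbackComp V) a b p =
      fderiv ℝ V p.1 (EuclideanSpace.single b 1) a + ∑ m, V p.1 m * chernCoeff L a m b p := by
  have hd : DifferentiableAt ℝ V p.1 := hV.differentiableAt (by simp)
  have h1 : fderiv ℝ (fun q : EuclideanSpace ℝ (Fin n) × EuclideanSpace ℝ (Fin n) => V q.1 a) p
      (horLift L (frame b) p) = fderiv ℝ V p.1 (EuclideanSpace.single b 1) a := by
    rw [fderiv_coord (X := fun q : EuclideanSpace ℝ (Fin n) × EuclideanSpace ℝ (Fin n) => V q.1)
      (hd.comp p differentiableAt_fst), fderiv_comp_fst hd, horLift_frame]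
  rw [hcov, deltaX_eq_fderiv]
  exact congrArg (· + _) h1

theorem deltaX_hcov_pullbackComp (h : IsRegularOn L U) (hp : p ∈ U) (hV : ContDiffAt ℝ 2 V p.1)
    (a b k : Fin n) :
    deltaX L k (hcov L (pullbackComp V) a b) p =
      fderiv ℝ (fun x => fderiv ℝ V x (EuclideanSpace.single b 1)) p.1
          (EuclideanSpace.single k 1) a
        + ∑ m, (fderiv ℝ V p.1 (EuclideanSpace.single k 1) m * chernCoeff L a m b p
          + V p.1 m * deltaX L k (chernCoeff L a m b) p) := by
  have hV1 : DifferentiableAt ℝ V p.1 := hV.differentiableAt (by simp)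
  have hd : DifferentiableAt ℝ (fun x => fderiv ℝ V x (EuclideanSpace.single b 1)) p.1 :=
    ((hV.fderiv_right (m := 1) (by norm_num)).differentiableAt (by simp)).clm_apply
      (differentiableAt_const _)
  have hd' : DifferentiableAt ℝ (fun q : EuclideanSpace ℝ (Fin n) × EuclideanSpace ℝ (Fin n) =>
      fderiv ℝ V q.1 (EuclideanSpace.single b 1)) p := hd.comp p differentiableAt_fst
  have hVf : DifferentiableAt ℝ (fun q : EuclideanSpace ℝ (Fin n) × EuclideanSpace ℝ (Fin n) =>
      V q.1) p := hV1.comp p differentiableAt_fst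
  have hVm : ∀ m, DifferentiableAt ℝ
      (fun q : EuclideanSpace ℝ (Fin n) × EuclideanSpace ℝ (Fin n) => V q.1 m) p :=
    differentiableAt_euclidean.1 hVf
  have hG : ∀ m, DifferentiableAt ℝ (chernCoeff L a m b) p := fun m =>
    differentiableAt_of_contDiffOn h.isOpen (h.contDiffOn_chernCoeff a m b) hp
  have h1 : hcov L (pullbackComp V) a b =ᶠ[nhds p] fun q =>
      fderiv ℝ V q.1 (EuclideanSpace.single b 1) a + ∑ m, V q.1 m * chernCoeff L a m b q :=
    (h.eventually_contDiffAt hp hV).mono fun q hq => hcov_pullbackComp hq.2 a b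
  rw [deltaX_eq_fderiv, h1.fderiv_eq, fderiv_fun_add (differentiableAt_euclidean.1 hd' a)
    (DifferentiableAt.fun_sum fun m _ => (hVm m).fun_mul (hG m)), add_apply,
    fderiv_sum_mul_apply hVm hG, fderiv_coord hd',
    fderiv_comp_fst (f := fun x => fderiv ℝ V x (EuclideanSpace.single b 1)) hd, horLift_frame]
  congr 1
  refine Finset.sum_congr rfl fun m _ => ?_
  rw [fderiv_coord hVf, fderiv_comp_fst hV1, deltaX_eq_fderiv, horLift_frame]

/-- The Lie derivative of the Chern connection in terms of its curvature and of the covariant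
derivatives of the vector field. -/
theorem lieChernCoeff_eq_curvature (h : IsRegularOn L U) (hp : p ∈ U)
    (hV : ContDiffAt ℝ 2 V p.1) (i j k : Fin n) :
    lieChernCoeff L V i j k p =
      (∑ m, chernR L j i m k p * V p.1 m)
      + hcov₁₁ L (hcov L (pullbackComp V)) i j k p
      + ∑ m, ∑ l, p.2 m * hcov L (pullbackComp V) l m p * landsbergP L j i k l p := by
  have hsym : ∀ a b c, chernCoeff L a b c p = chernCoeff L a c b p := fun a b c =>
    h.chernCoeff_comm hp a b c
  have hf : ∀ a b c, fderiv ℝ (chernCoeff L a b c) p = fderiv ℝ (chernCoeff L a c b) p :=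
    fun a b c => fderiv_congr_on h.isOpen (fun q hq => h.chernCoeff_comm hq a b c) hp
  have hδ : ∀ a b c m, deltaX L m (chernCoeff L a b c) p = deltaX L m (chernCoeff L a c b) p :=
    fun a b c m => by rw [deltaX_eq_fderiv, deltaX_eq_fderiv, hf]
  have hdx : ∀ m, dx m (chernCoeff L i j k) p = deltaX L m (chernCoeff L i j k) p
      + ∑ l, nonlinCoeff L l m p * dy l (chernCoeff L i j k) p := fun m => by
    rw [deltaX]; ring
  have hy : ∀ l, fderiv ℝ V p.1 p.2 l =
      ∑ m, p.2 m * fderiv ℝ V p.1 (EuclideanSpace.single m 1) l := fun l => by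
    rw [map_eq_sum_single]; simp
  rw [h.lieChernCoeff_eq hp hV, hf, fderiv_eq_sum_dx_dy, hcov₁₁,
    h.deltaX_hcov_pullbackComp hp hV, fderiv_fderiv_apply_comm hV]
  simp only [hcov_pullbackComp hV, chernR, landsbergP, hdx, completeLift, hy,
    ← h.sum_chernCoeff_mul hp]
  have key := sum_lie_eq_sum_curvature (fun a b c => chernCoeff L a b c p) hsym
    (fun m => V p.1 m) (fun m => p.2 m) (fun l => dy l (chernCoeff L i j k) p)
    (fun m => deltaX L m (chernCoeff L i j k) p) (fun m => deltaX L k (chernCoeff L i j m) p)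
    (fun m l => fderiv ℝ V p.1 (EuclideanSpace.single m 1) l)
    (fderiv ℝ (fun x => fderiv ℝ V x (EuclideanSpace.single j 1)) p.1
      (EuclideanSpace.single k 1) i) i j k
  -- The lower indices of the derivative coming from V_{|j|k} are swapped, so that it cancels the
  -- term -δΓⁱ_jm/δxᵏ of the curvature.
  simp only [hδ i _ j k]
  exact key

end IsRegularOn

end Components

/-! ### From the manifold to a chart. -/

theorem isOpen_setOf_fst_mem_and_snd_ne_zero {n : ℕ} {s : Set (EuclideanSpace ℝ (Fin n))}
    (hs : IsOpen s) : IsOpen {p : EuclideanSpace ℝ (Fin n) × EuclideanSpace ℝ (Fin n) |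
      p.1 ∈ s ∧ p.2 ≠ 0} :=
  (hs.preimage continuous_fst).inter (isOpen_ne_fun continuous_snd continuous_const)

section Charts

variable {n : ℕ} {M : Type*} [TopologicalSpace M] [ChartedSpace (EuclideanSpace ℝ (Fin n)) M]
  {e : OpenPartialHomeomorph M (EuclideanSpace ℝ (Fin n))}
  {F : TangentBundle (𝓡 n) M → ℝ} {x y : EuclideanSpace ℝ (Fin n)}

theorem mdifferentiable_of_mem_maximalAtlas (he : e ∈ IsManifold.maximalAtlas (𝓡 n) ∞ M) :
    e.MDifferentiable (𝓡 n) (𝓡 n) :=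
  ⟨(contMDiffOn_of_mem_maximalAtlas he).mdifferentiableOn (by simp),
    (contMDiffOn_symm_of_mem_maximalAtlas he).mdifferentiableOn (by simp)⟩

/-- Keeps the parametrization off the zero section, where F need not be smooth. -/
theorem mfderiv_symm_ne_zero (he : e ∈ IsManifold.maximalAtlas (𝓡 n) ∞ M) (hx : x ∈ e.target)
    (hy : y ≠ 0) : mfderiv (𝓡 n) (𝓡 n) e.symm x y ≠ 0 := by
  have h := (mdifferentiable_of_mem_maximalAtlas he).symm.mfderiv_injective (x := x) hx
  intro h0
  exact hy (h (h0.trans (map_zero _).symm))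

theorem contMDiff_totalSpace_mk_modelSpace :
    ContMDiff 𝓘(ℝ, EuclideanSpace ℝ (Fin n) × EuclideanSpace ℝ (Fin n)) (𝓡 n).tangent ∞
      (fun p : EuclideanSpace ℝ (Fin n) × EuclideanSpace ℝ (Fin n) =>
        (⟨p.1, p.2⟩ : TangentBundle (𝓡 n) (EuclideanSpace ℝ (Fin n)))) := by
  intro p
  apply Bundle.contMDiffAt_totalSpace.2
  refine ⟨contDiff_fst.contMDiff.contMDiffAt, ?_⟩
  simpa using contDiff_snd.contMDiff.contMDiffAt

variable [IsManifold (𝓡 n) ∞ M]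

/-- The induced parametrization of the tangent bundle is smooth. -/
theorem contMDiffOn_tangentMap_symm (he : e ∈ IsManifold.maximalAtlas (𝓡 n) ∞ M) :
    ContMDiffOn 𝓘(ℝ, EuclideanSpace ℝ (Fin n) × EuclideanSpace ℝ (Fin n)) (𝓡 n).tangent ∞
      (fun p : EuclideanSpace ℝ (Fin n) × EuclideanSpace ℝ (Fin n) =>
        (⟨e.symm p.1, mfderiv (𝓡 n) (𝓡 n) e.symm p.1 p.2⟩ : TangentBundle (𝓡 n) M))
      {p | p.1 ∈ e.target} := by
  have h1 := (contMDiffOn_symm_of_mem_maximalAtlas he).contMDiffOn_tangentMapWithin (m := ∞)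
    (by simp) e.open_target.uniqueMDiffOn
  refine (h1.comp contMDiff_totalSpace_mk_modelSpace.contMDiffOn
    (s := {p : EuclideanSpace ℝ (Fin n) × EuclideanSpace ℝ (Fin n) | p.1 ∈ e.target}) fun p hp => hp).congr fun p hp => ?_
  exact (tangentMapWithin_eq_tangentMap (p := (⟨p.1, p.2⟩ : TangentBundle (𝓡 n) _))
    (e.open_target.uniqueMDiffWithinAt hp)
    ((mdifferentiable_of_mem_maximalAtlas he).mdifferentiableAt_symm hp)).symm

theorem contDiffOn_localMetric (hF : IsFinslerMetric F)
    (he : e ∈ IsManifold.maximalAtlas (𝓡 n) ∞ M) :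
    ContDiffOn ℝ ∞ (localMetric e F) {p | p.1 ∈ e.target ∧ p.2 ≠ 0} := by
  refine ContMDiffOn.contDiffOn ?_
  exact hF.smooth.comp ((contMDiffOn_tangentMap_symm he).mono fun p hp => hp.1)
    fun p hp => mfderiv_symm_ne_zero he hp.1 hp.2

/-- On the target, the local field is the fibre part of the tangent map of `e` composed with V and
`e.symm`. -/
theorem contDiffAt_localField {V : ∀ p : M, TangentSpace (𝓡 n) p}
    (hV : ContMDiff (𝓡 n) (𝓡 n).tangent 2 fun p => (⟨p, V p⟩ : TangentBundle (𝓡 n) M))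
    (he : e ∈ IsManifold.maximalAtlas (𝓡 n) ∞ M) (hx : x ∈ e.target) :
    ContDiffAt ℝ 2 (localField e V) x := by
  have h1 := (contMDiffOn_of_mem_maximalAtlas he).contMDiffOn_tangentMapWithin (m := 2)
    (by norm_cast) e.open_source.uniqueMDiffOn
  have h2 : ContMDiffOn (𝓡 n) (𝓡 n) 2 e.symm e.target :=
    (contMDiffOn_symm_of_mem_maximalAtlas he).of_le (WithTop.coe_le_coe.2 (le_top : (2 : ℕ∞) ≤ ⊤))
  have h3 := (contMDiff_snd_tangentBundle_modelSpace (EuclideanSpace ℝ (Fin n)) (𝓡 n) (n := 2)).comp_contMDiffOn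
    (h1.comp (hV.comp_contMDiffOn h2) fun z hz => e.map_target hz)
  refine (ContDiffOn.contDiffAt (s := e.target) ?_ (e.open_target.mem_nhds hx))
  refine (ContMDiffOn.congr h3 ?_).contDiffOn
  intro z hz
  exact (congrArg (fun A => A (V (e.symm z))) (mfderivWithin_of_isOpen (I := 𝓡 n) (I' := 𝓡 n)
    (f := e) e.open_source (e.map_target hz))).symm

theorem localMetric_smul (hF : IsFinslerMetric F) {c : ℝ} (hc : 0 < c) :
    localMetric e F (x, c • y) = c * localMetric e F (x, y) := by
  have h : mfderiv (𝓡 n) (𝓡 n) e.symm x (c • y) = c • mfderiv (𝓡 n) (𝓡 n) e.symm x y :=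
    ContinuousLinearMap.map_smul _ c y
  exact (congrArg (fun v => F ⟨e.symm x, v⟩) h).trans (hF.homogeneous _ _ c hc)

/-- The fundamental form is represented by the fundamental tensor. -/
theorem fundamentalForm_eq (hF : IsFinslerMetric F)
    (he : e ∈ IsManifold.maximalAtlas (𝓡 n) ∞ M) (hx : x ∈ e.target) (hy : y ≠ 0)
    (u : EuclideanSpace ℝ (Fin n)) :
    fundamentalForm F (e.symm x) (mfderiv (𝓡 n) (𝓡 n) e.symm x y)
      (mfderiv (𝓡 n) (𝓡 n) e.symm x u) (mfderiv (𝓡 n) (𝓡 n) e.symm x u) =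
      ∑ i, ∑ j, u i * metricCoeff (localMetric e F) (x, y) i j * u j := by
  set U := {p : EuclideanSpace ℝ (Fin n) × EuclideanSpace ℝ (Fin n) |
      p.1 ∈ e.target ∧ p.2 ≠ 0} with hU
  set φ : EuclideanSpace ℝ (Fin n) × EuclideanSpace ℝ (Fin n) → ℝ :=
    fun q => localMetric e F q ^ 2 with hφ
  have hUo : IsOpen U := isOpen_setOf_fst_mem_and_snd_ne_zero e.open_target
  have hs : ContDiffOn ℝ ∞ φ U := (contDiffOn_localMetric hF he).pow 2
  have hp : (x, y) ∈ U := ⟨hx, hy⟩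
  have hline : ∀ {f : EuclideanSpace ℝ (Fin n) × EuclideanSpace ℝ (Fin n) → ℝ}
      {z : EuclideanSpace ℝ (Fin n)}, DifferentiableAt ℝ f (x, z) →
      deriv (fun t : ℝ => f (x, z + t • u)) 0 = fderiv ℝ f (x, z) (0, u) := by
    intro f z hf
    have h1 : HasDerivAt (fun t : ℝ => (x, z + t • u)) ((0 : EuclideanSpace ℝ (Fin n)), u) 0 := by
      have := ((hasDerivAt_id (0 : ℝ)).smul_const u).const_add z
      exact (hasDerivAt_const 0 x).prodMk (by simpa using this)
    have h2 : HasFDerivAt f (fderiv ℝ f (x, z)) (x, z + (0 : ℝ) • u) := by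
      simpa using hf.hasFDerivAt
    exact (h2.comp_hasDerivAt 0 h1).deriv
  -- The outer derivative needs the inner one for all small s; openness keeps y + su nonzero there.
  have h1 : (fun s : ℝ => deriv (fun t : ℝ => φ (x, y + s • u + t • u)) 0) =ᶠ[nhds 0]
      fun s => fderiv ℝ φ (x, y + s • u) (0, u) := by
    have hc : ContinuousAt (fun s : ℝ => (x, y + s • u)) 0 := by fun_prop
    have hp' : (x, y + (0 : ℝ) • u) ∈ U := by simpa using hp
    filter_upwards [hc.eventually (hUo.eventually_mem hp')] with s hs'
    exact hline (differentiableAt_of_contDiffOn hUo hs hs')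
  have h2 : fundamentalForm F (e.symm x) (mfderiv (𝓡 n) (𝓡 n) e.symm x y)
      (mfderiv (𝓡 n) (𝓡 n) e.symm x u) (mfderiv (𝓡 n) (𝓡 n) e.symm x u) =
      (1 / 2) * deriv (fun s : ℝ => deriv (fun t : ℝ => φ (x, y + s • u + t • u)) 0) 0 := by
    have h : ∀ s t : ℝ, mfderiv (𝓡 n) (𝓡 n) e.symm x (y + s • u + t • u) =
        mfderiv (𝓡 n) (𝓡 n) e.symm x y + s • mfderiv (𝓡 n) (𝓡 n) e.symm x u
          + t • mfderiv (𝓡 n) (𝓡 n) e.symm x u := fun s t => by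
      refine (ContinuousLinearMap.map_add _ _ _).trans ?_
      refine congrArg₂ (· + ·) ((ContinuousLinearMap.map_add _ _ _).trans ?_)
        (ContinuousLinearMap.map_smul _ t u)
      exact congrArg (_ + ·) (ContinuousLinearMap.map_smul _ s u)
    simp only [fundamentalForm, hφ, localMetric, h]
  have h3 : (fun q => fderiv ℝ φ q (0, u)) = fun q => ∑ i, u i * dy i φ q := by
    funext q
    rw [fderiv_eq_sum_dx_dy]
    simp
  rw [h2, h1.deriv_eq, hline (f := fun q => fderiv ℝ φ q (0, u))
    (differentiableAt_of_contDiffOn hUo (contDiffOn_fderiv_apply hUo hs _) hp), h3,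
    fderiv_eq_sum_dx_dy]
  have h4 : ∀ j, dy j (fun q => ∑ i, u i * dy i φ q) (x, y) =
      ∑ i, u i * dy j (dy i φ) (x, y) := by
    intro j
    rw [dy, fderiv_sum_mul_apply (fun i => differentiableAt_const _)
      (fun i => differentiableAt_of_contDiffOn hUo (contDiffOn_dy hUo hs i) hp)]
    simp [dy]
  simp only [h4, PiLp.zero_apply, zero_mul, Finset.sum_const_zero, zero_add, Finset.mul_sum,
    metricCoeff, Matrix.of_apply]
  rw [Finset.sum_comm]
  exact Finset.sum_congr rfl fun _ _ => Finset.sum_congr rfl fun _ _ => by ring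

/-- A kernel vector of g would make the fundamental form vanish on a nonzero vector. Euler's
relation is the derivative at t = 1 of F²(x, ty) = t² F²(x, y). -/
theorem isRegularOn_localMetric (hF : IsFinslerMetric F)
    (he : e ∈ IsManifold.maximalAtlas (𝓡 n) ∞ M) :
    IsRegularOn (localMetric e F) {p | p.1 ∈ e.target ∧ p.2 ≠ 0} := by
  have hs : ContDiffOn ℝ ∞ (fun q => localMetric e F q ^ 2) {p | p.1 ∈ e.target ∧ p.2 ≠ 0} :=
    (contDiffOn_localMetric hF he).pow 2
  refine ⟨isOpen_setOf_fst_mem_and_snd_ne_zero e.open_target, hs, ?_, ?_⟩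
  · rintro ⟨x, y⟩ ⟨hx, hy⟩
    rw [isUnit_iff_ne_zero]
    intro hdet
    obtain ⟨u, hu, hu0⟩ := Matrix.exists_mulVec_eq_zero_iff.2 hdet
    have hw : (WithLp.toLp 2 u : EuclideanSpace ℝ (Fin n)) ≠ 0 := by simpa using hu
    have h1 := hF.posDef (e.symm x) (mfderiv (𝓡 n) (𝓡 n) e.symm x y) _
      (mfderiv_symm_ne_zero he hx hy) (mfderiv_symm_ne_zero he hx hw)
    rw [fundamentalForm_eq hF he hx hy] at h1
    refine h1.ne' (Finset.sum_eq_zero fun i _ => ?_)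
    have h2 := congrFun hu0 i
    simp only [Matrix.mulVec, dotProduct, Pi.zero_apply] at h2
    simp only [mul_assoc, ← Finset.mul_sum]
    exact mul_eq_zero_of_right _ h2
  · rintro ⟨x, y⟩ hp
    have h1 : HasDerivAt (fun t : ℝ => (x, t • y)) ((0 : EuclideanSpace ℝ (Fin n)), y) 1 := by
      have := (hasDerivAt_id (1 : ℝ)).smul_const y
      exact (hasDerivAt_const 1 x).prodMk (by simpa using this)
    have h2 : HasFDerivAt (fun q => localMetric e F q ^ 2)
        (fderiv ℝ (fun q => localMetric e F q ^ 2) (x, y)) (x, (1 : ℝ) • y) := by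
      simpa using (differentiableAt_of_contDiffOn (isOpen_setOf_fst_mem_and_snd_ne_zero e.open_target) hs hp).hasFDerivAt
    have h3 := h2.comp_hasDerivAt (1 : ℝ) h1
    have h4 : HasDerivAt (fun t : ℝ => t ^ 2 * localMetric e F (x, y) ^ 2)
        (2 * localMetric e F (x, y) ^ 2) 1 := by
      simpa using (hasDerivAt_pow 2 (1 : ℝ)).mul_const (localMetric e F (x, y) ^ 2)
    have h5 : (fun t : ℝ => t ^ 2 * localMetric e F (x, y) ^ 2) =ᶠ[nhds 1]
        (fun q => localMetric e F q ^ 2) ∘ fun t : ℝ => (x, t • y) := by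
      -- Homogeneity is available only for t > 0, which suffices near t = 1.
      filter_upwards [lt_mem_nhds (zero_lt_one' ℝ)] with t ht
      simp only [Function.comp_apply, localMetric_smul hF ht]
      ring
    have h6 := h4.unique (h3.congr_of_eventuallyEq h5)
    rw [h6, fderiv_eq_sum_dx_dy]
    simp [mul_comm]

end Charts

end Finsler

end

theorem theorem5p1 {n : ℕ} {M : Type*} [TopologicalSpace M]
    [ChartedSpace (EuclideanSpace ℝ (Fin n)) M] [IsManifold (𝓡 n) ∞ M]
    (F : TangentBundle (𝓡 n) M → ℝ) (hF : Finsler.IsFinslerMetric F)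
    (V : ∀ p : M, TangentSpace (𝓡 n) p)
    (hV : ContMDiff (𝓡 n) (𝓡 n).tangent 2 fun p => (⟨p, V p⟩ : TangentBundle (𝓡 n) M))
    (e : OpenPartialHomeomorph M (EuclideanSpace ℝ (Fin n)))
    (he : e ∈ IsManifold.maximalAtlas (𝓡 n) ∞ M)
    (x y : EuclideanSpace ℝ (Fin n)) (hx : x ∈ e.target) (hy : y ≠ 0) (i j k : Fin n) :
    Finsler.lieChernCoeff (Finsler.localMetric e F) (Finsler.localField e V) i j k (x, y) =
      (∑ m, Finsler.chernR (Finsler.localMetric e F) j i m k (x, y) * Finsler.localField e V x m)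
      + Finsler.hcov₁₁ (Finsler.localMetric e F)
          (Finsler.hcov (Finsler.localMetric e F)
            (Finsler.pullbackComp (Finsler.localField e V))) i j k (x, y)
      + ∑ m, ∑ l, y m *
          Finsler.hcov (Finsler.localMetric e F)
            (Finsler.pullbackComp (Finsler.localField e V)) l m (x, y) *
          Finsler.landsbergP (Finsler.localMetric e F) j i k l (x, y) :=
  (Finsler.isRegularOn_localMetric hF he).lieChernCoeff_eq_curvature (p := (x, y)) ⟨hx, hy⟩
    (Finsler.contDiffAt_localField hV he hx) i j k
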